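/- Let $\mathrm{Var}$ be a set of variables (for example a countably infinite one). Formulae of $\mathbf{ACT}_\omega$ are built from variables and the constants $0,1$ by $\backslash,\ /,\ \cdot,\ \oplus,\ \&$ and ${}^*$; formulae of ${!}\mathbf{ACT}_\omega$ may in addition use the unary modality ${!}$. A sequent $\Pi\Rightarrow C$ consists of a finite, possibly empty, sequence $\Pi$ of formulae and a formula $C$. The rules of $\mathbf{ACT}_\omega$ are as follows (premises before the arrow $\vdash$, conclusion after it; $i\in\{1,2\}$; $A^n$ inside a sequent stands for $n$ copies of $A$): - $(\mathrm{Id})$: $\vdash A\Rightarrow A$; - $(\backslash L)$: $\Pi\Rightarrow A;\ \Gamma,B,\Delta\Rightarrow C\ \vdash\ \Gamma,\Pi,A\backslash B,\Delta\Rightarrow C$, and $(\backslash R)$: $A,\Pi\Rightarrow B\ \vdash\ \Pi\Rightarrow A\backslash B$; - $(/L)$: $\Pi\Rightarrow A;\ \Gamma,B,\Delta\Rightarrow C\ \vdash\ \Gamma,B/A,\Pi,\Delta\Rightarrow C$, and $(/R)$: $\Pi,A\Rightarrow B\ \vdash\ \Pi\Rightarrow B/A$; - $(\cdot L)$: $\Gamma,A,B,\Delta\Rightarrow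 C\ \vdash\ \Gamma,A\cdot B,\Delta\Rightarrow C$, and $(\cdot R)$: $\Gamma\Rightarrow A;\ \Delta\Rightarrow B\ \vdash\ \Gamma,\Delta\Rightarrow A\cdot B$; - $(1L)$: $\Gamma,\Delta\Rightarrow C\ \vdash\ \Gamma,1,\Delta\Rightarrow C$; $(1R)$: $\vdash\ \Rightarrow 1$; $(0L)$: $\vdash\Gamma,0,\Delta\Rightarrow C$; - $(\oplus L)$: $\Gamma,A_1,\Delta\Rightarrow C;\ \Gamma,A_2,\Delta\Rightarrow C\ \vdash\ \Gamma,A_1\oplus A_2,\Delta\Rightarrow C$, and $(\oplus R_i)$: $\Pi\Rightarrow A_i\ \vdash\ \Pi\Rightarrow A_1\oplus A_2$; - $(\& L_i)$: $\Gamma,A_i,\Delta\Rightarrow C\ \vdash\ \Gamma,A_1\& A_2,\Delta\Rightarrow C$, and $(\& R)$: $\Pi\Rightarrow A_1;\ \Pi\Rightarrow A_2\ \vdash\ \Pi\Rightarrow A_1\& A_2$; - $({}^*L_\omega)$: $\Gamma,A^n,\Delta\Rightarrow C$ for all $n\in\omega$ $\ \vdash\ \Gamma,A^*,\Delta\Rightarrow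 C$, and $({}^*R_n)$, for each $n\geq 0$: $\Pi_1\Rightarrow A;\ \ldots;\ \Pi_n\Rightarrow A\ \vdash\ \Pi_1,\ldots,\Pi_n\Rightarrow A^*$; - $(\mathrm{Cut})$: $\Pi\Rightarrow A;\ \Gamma,A,\Delta\Rightarrow C\ \vdash\ \Gamma,\Pi,\Delta\Rightarrow C$. The calculus ${!}\mathbf{ACT}_\omega$ has the same rules, for formulae of the extended language, and moreover, with ${!}\Pi={!}A_1,\ldots,{!}A_n$ for $\Pi=A_1,\ldots,A_n$: - $({!}L)$: $\Gamma,A,\Delta\Rightarrow C\ \vdash\ \Gamma,{!}A,\Delta\Rightarrow C$, and $({!}R)$: ${!}\Pi\Rightarrow B\ \vdash\ {!}\Pi\Rightarrow{!}B$; - $({!}P_1)$: $\Gamma,\Pi,{!}A,\Delta\Rightarrow C\ \vdash\ \Gamma,{!}A,\Pi,\Delta\Rightarrow C$, and $({!}P_2)$: $\Gamma,{!}A,\Pi,\Delta\Rightarrow C\ \vdash\ \Gamma,\Pi,{!}A,\Delta\Rightarrow C$; - $({!}W)$: $\Gamma,\Delta\Rightarrow C\ \vdash\ \Gamma,{!}A,\Delta\Rightarrow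 C$, and $({!}C)$: $\Gamma,{!}A,{!}A,\Delta\Rightarrow C\ \vdash\ \Gamma,{!}A,\Delta\Rightarrow C$. A sequent is derivable from a set $S$ of sequents (hypotheses) if it belongs to the least set of sequents that includes $S$ and is closed under the rules, that is, if it has a well-founded, possibly infinite, derivation tree whose leaves are axioms or members of $S$. Derivable without further mention means derivable from $\varnothing$. **Theorem 2.4.** Let $S$ be a finite set of sequents in the language of $\mathbf{ACT}_\omega$. To each sequent $A_1,\ldots,A_n\Rightarrow B$ in $S$ associate the formula $(A_1\cdot\ldots\cdot A_n)\backslash B$ (with the product associated to the left) if $n\geq1$, and the formula $B$ if $n=0$. Let $\Upsilon_S$ be a finite sequence of all these formulae, in an arbitrary order and possibly with repetitions. Then, for every sequent $\Pi\Rightarrow C$ in the language of $\mathbf{ACT}_\omega$, the sequent $\Pi\Rightarrow C$ is derivable in $\mathbf{ACT}_\omega$ from $S$ if and only if the sequent ${!}\Upsilon_S,\Pi\Rightarrow C$ is derivable in ${!}\mathbf{ACT}_\omega$. -/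

import Mathlib

namespace ActionLogic

universe u

/-- Formulae of infinitary action logic over a set `V` of variables. -/
inductive Formula (V : Type u) : Type u where
  | var : V → Formula V
  | zero : Formula V
  | one : Formula V
  /-- `under A B` is the left division `A \ B`. -/
  | under : Formula V → Formula V → Formula V
  /-- `over B A` is the right division `B / A`. -/
  | over : Formula V → Formula V → Formula V
  /-- The product `A · B`. -/
  | mul : Formula V → Formula V → Formula V
  /-- The join `A ⊕ B`. -/
  | plus : Formula V → Formula V → Formula V
  /-- The meet `A & B`. -/
  | meet : Formula V → Formula V → Formula V
  /-- The Kleene star `A*`. -/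
  | star : Formula V → Formula V

/-- Formulae of infinitary action logic with exponentiation: the language is
extended by the exponential modality `bang`. -/
inductive ExpFormula (V : Type u) : Type u where
  | var : V → ExpFormula V
  | zero : ExpFormula V
  | one : ExpFormula V
  | under : ExpFormula V → ExpFormula V → ExpFormula V
  | over : ExpFormula V → ExpFormula V → ExpFormula V
  | mul : ExpFormula V → ExpFormula V → ExpFormula V
  | plus : ExpFormula V → ExpFormula V → ExpFormula V
  | meet : ExpFormula V → ExpFormula V → ExpFormula V
  | star : ExpFormula V → ExpFormula V
  /-- The exponential `!A`. -/
  | bang : ExpFormula V → ExpFormula V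

/-- Every formula without the exponential is a formula of the extended language. -/
def Formula.toExp {V : Type u} : Formula V → ExpFormula V
  | .var p => .var p
  | .zero => .zero
  | .one => .one
  | .under A B => .under A.toExp B.toExp
  | .over B A => .over B.toExp A.toExp
  | .mul A B => .mul A.toExp B.toExp
  | .plus A B => .plus A.toExp B.toExp
  | .meet A B => .meet A.toExp B.toExp
  | .star A => .star A.toExp

/-- A sequent `Φ ⇒ B` (in the language without the exponential): a finite sequence of
formulae, possibly empty, and a formula. -/
structure Sequent (V : Type u) : Type u where
  ant : List (Formula V)
  succ : Formula V

/-- `Derivable S Φ C`: the sequent `Φ ⇒ C` is derivable in infinitary action logic from the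
set `S` of hypotheses, i.e. it belongs to the least set of sequents that contains `S` and
is closed under the inference rules (equivalently, it has a well-founded derivation tree). -/
inductive Derivable {V : Type u} (S : Set (Sequent V)) :
    List (Formula V) → Formula V → Prop where
  | hyp (s : Sequent V) : s ∈ S → Derivable S s.ant s.succ
  | id (A : Formula V) : Derivable S [A] A
  | underL (Γ Φ Δ : List (Formula V)) (A B C : Formula V) :
      Derivable S Φ A → Derivable S (Γ ++ [B] ++ Δ) C →
      Derivable S (Γ ++ Φ ++ [.under A B] ++ Δ) C
  | underR (Φ : List (Formula V)) (A B : Formula V) :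
      Derivable S ([A] ++ Φ) B → Derivable S Φ (.under A B)
  | overL (Γ Φ Δ : List (Formula V)) (A B C : Formula V) :
      Derivable S Φ A → Derivable S (Γ ++ [B] ++ Δ) C →
      Derivable S (Γ ++ [.over B A] ++ Φ ++ Δ) C
  | overR (Φ : List (Formula V)) (A B : Formula V) :
      Derivable S (Φ ++ [A]) B → Derivable S Φ (.over B A)
  | mulL (Γ Δ : List (Formula V)) (A B C : Formula V) :
      Derivable S (Γ ++ [A, B] ++ Δ) C → Derivable S (Γ ++ [.mul A B] ++ Δ) C
  | mulR (Γ Δ : List (Formula V)) (A B : Formula V) :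
      Derivable S Γ A → Derivable S Δ B → Derivable S (Γ ++ Δ) (.mul A B)
  | oneL (Γ Δ : List (Formula V)) (C : Formula V) :
      Derivable S (Γ ++ Δ) C → Derivable S (Γ ++ [.one] ++ Δ) C
  | oneR : Derivable S [] .one
  | zeroL (Γ Δ : List (Formula V)) (C : Formula V) : Derivable S (Γ ++ [.zero] ++ Δ) C
  | plusL (Γ Δ : List (Formula V)) (A₁ A₂ C : Formula V) :
      Derivable S (Γ ++ [A₁] ++ Δ) C → Derivable S (Γ ++ [A₂] ++ Δ) C →
      Derivable S (Γ ++ [.plus A₁ A₂] ++ Δ) C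
  | plusR₁ (Φ : List (Formula V)) (A₁ A₂ : Formula V) :
      Derivable S Φ A₁ → Derivable S Φ (.plus A₁ A₂)
  | plusR₂ (Φ : List (Formula V)) (A₁ A₂ : Formula V) :
      Derivable S Φ A₂ → Derivable S Φ (.plus A₁ A₂)
  | meetL₁ (Γ Δ : List (Formula V)) (A₁ A₂ C : Formula V) :
      Derivable S (Γ ++ [A₁] ++ Δ) C → Derivable S (Γ ++ [.meet A₁ A₂] ++ Δ) C
  | meetL₂ (Γ Δ : List (Formula V)) (A₁ A₂ C : Formula V) :
      Derivable S (Γ ++ [A₂] ++ Δ) C → Derivable S (Γ ++ [.meet A₁ A₂] ++ Δ) C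
  | meetR (Φ : List (Formula V)) (A₁ A₂ : Formula V) :
      Derivable S Φ A₁ → Derivable S Φ A₂ → Derivable S Φ (.meet A₁ A₂)
  /-- The `ω`-rule: one premise for each `n`, with `n` copies of `A` in place of `A*`. -/
  | starL (Γ Δ : List (Formula V)) (A C : Formula V) :
      (∀ n : ℕ, Derivable S (Γ ++ List.replicate n A ++ Δ) C) →
      Derivable S (Γ ++ [.star A] ++ Δ) C
  /-- The rules `(*R_n)`, `n ≥ 0`; here `Φs` is the list of antecedents `Φ₁, …, Φₙ`. -/
  | starR (Φs : List (List (Formula V))) (A : Formula V) :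
      (∀ Φ ∈ Φs, Derivable S Φ A) → Derivable S Φs.flatten (.star A)
  | cut (Γ Φ Δ : List (Formula V)) (A C : Formula V) :
      Derivable S Φ A → Derivable S (Γ ++ [A] ++ Δ) C → Derivable S (Γ ++ Φ ++ Δ) C

/-- `ExpDerivable Φ C`: the sequent `Φ ⇒ C` is derivable (without hypotheses) in infinitary
action logic with exponentiation. -/
inductive ExpDerivable {V : Type u} : List (ExpFormula V) → ExpFormula V → Prop where
  | id (A : ExpFormula V) : ExpDerivable [A] A
  | underL (Γ Φ Δ : List (ExpFormula V)) (A B C : ExpFormula V) :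
      ExpDerivable Φ A → ExpDerivable (Γ ++ [B] ++ Δ) C →
      ExpDerivable (Γ ++ Φ ++ [.under A B] ++ Δ) C
  | underR (Φ : List (ExpFormula V)) (A B : ExpFormula V) :
      ExpDerivable ([A] ++ Φ) B → ExpDerivable Φ (.under A B)
  | overL (Γ Φ Δ : List (ExpFormula V)) (A B C : ExpFormula V) :
      ExpDerivable Φ A → ExpDerivable (Γ ++ [B] ++ Δ) C →
      ExpDerivable (Γ ++ [.over B A] ++ Φ ++ Δ) C
  | overR (Φ : List (ExpFormula V)) (A B : ExpFormula V) :
      ExpDerivable (Φ ++ [A]) B → ExpDerivable Φ (.over B A)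
  | mulL (Γ Δ : List (ExpFormula V)) (A B C : ExpFormula V) :
      ExpDerivable (Γ ++ [A, B] ++ Δ) C → ExpDerivable (Γ ++ [.mul A B] ++ Δ) C
  | mulR (Γ Δ : List (ExpFormula V)) (A B : ExpFormula V) :
      ExpDerivable Γ A → ExpDerivable Δ B → ExpDerivable (Γ ++ Δ) (.mul A B)
  | oneL (Γ Δ : List (ExpFormula V)) (C : ExpFormula V) :
      ExpDerivable (Γ ++ Δ) C → ExpDerivable (Γ ++ [.one] ++ Δ) C
  | oneR : ExpDerivable [] .one
  | zeroL (Γ Δ : List (ExpFormula V)) (C : ExpFormula V) : ExpDerivable (Γ ++ [.zero] ++ Δ) C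
  | plusL (Γ Δ : List (ExpFormula V)) (A₁ A₂ C : ExpFormula V) :
      ExpDerivable (Γ ++ [A₁] ++ Δ) C → ExpDerivable (Γ ++ [A₂] ++ Δ) C →
      ExpDerivable (Γ ++ [.plus A₁ A₂] ++ Δ) C
  | plusR₁ (Φ : List (ExpFormula V)) (A₁ A₂ : ExpFormula V) :
      ExpDerivable Φ A₁ → ExpDerivable Φ (.plus A₁ A₂)
  | plusR₂ (Φ : List (ExpFormula V)) (A₁ A₂ : ExpFormula V) :
      ExpDerivable Φ A₂ → ExpDerivable Φ (.plus A₁ A₂)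
  | meetL₁ (Γ Δ : List (ExpFormula V)) (A₁ A₂ C : ExpFormula V) :
      ExpDerivable (Γ ++ [A₁] ++ Δ) C → ExpDerivable (Γ ++ [.meet A₁ A₂] ++ Δ) C
  | meetL₂ (Γ Δ : List (ExpFormula V)) (A₁ A₂ C : ExpFormula V) :
      ExpDerivable (Γ ++ [A₂] ++ Δ) C → ExpDerivable (Γ ++ [.meet A₁ A₂] ++ Δ) C
  | meetR (Φ : List (ExpFormula V)) (A₁ A₂ : ExpFormula V) :
      ExpDerivable Φ A₁ → ExpDerivable Φ A₂ → ExpDerivable Φ (.meet A₁ A₂)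
  | starL (Γ Δ : List (ExpFormula V)) (A C : ExpFormula V) :
      (∀ n : ℕ, ExpDerivable (Γ ++ List.replicate n A ++ Δ) C) →
      ExpDerivable (Γ ++ [.star A] ++ Δ) C
  | starR (Φs : List (List (ExpFormula V))) (A : ExpFormula V) :
      (∀ Φ ∈ Φs, ExpDerivable Φ A) → ExpDerivable Φs.flatten (.star A)
  | cut (Γ Φ Δ : List (ExpFormula V)) (A C : ExpFormula V) :
      ExpDerivable Φ A → ExpDerivable (Γ ++ [A] ++ Δ) C → ExpDerivable (Γ ++ Φ ++ Δ) C
  | bangL (Γ Δ : List (ExpFormula V)) (A C : ExpFormula V) :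
      ExpDerivable (Γ ++ [A] ++ Δ) C → ExpDerivable (Γ ++ [.bang A] ++ Δ) C
  | bangR (Φ : List (ExpFormula V)) (B : ExpFormula V) :
      ExpDerivable (Φ.map .bang) B → ExpDerivable (Φ.map .bang) (.bang B)
  | bangP₁ (Γ Φ Δ : List (ExpFormula V)) (A C : ExpFormula V) :
      ExpDerivable (Γ ++ Φ ++ [.bang A] ++ Δ) C → ExpDerivable (Γ ++ [.bang A] ++ Φ ++ Δ) C
  | bangP₂ (Γ Φ Δ : List (ExpFormula V)) (A C : ExpFormula V) :
      ExpDerivable (Γ ++ [.bang A] ++ Φ ++ Δ) C → ExpDerivable (Γ ++ Φ ++ [.bang A] ++ Δ) C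
  | bangW (Γ Δ : List (ExpFormula V)) (A C : ExpFormula V) :
      ExpDerivable (Γ ++ Δ) C → ExpDerivable (Γ ++ [.bang A] ++ Δ) C
  | bangC (Γ Δ : List (ExpFormula V)) (A C : ExpFormula V) :
      ExpDerivable (Γ ++ [.bang A, .bang A] ++ Δ) C → ExpDerivable (Γ ++ [.bang A] ++ Δ) C

/-- The product `A · A₁ · … · Aₖ`, associated to the left, of a nonempty sequence of formulae
with first member `A`. -/
def prod {V : Type u} (A : Formula V) (As : List (Formula V)) : Formula V :=
  As.foldl .mul A

/-- The formula `(A₁ · … · Aₙ) \ B` that represents the sequent `A₁, …, Aₙ ⇒ B`;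
for `n = 0` it is just `B`. -/
def Sequent.toFormula {V : Type u} : Sequent V → Formula V
  | ⟨[], B⟩ => B
  | ⟨A :: As, B⟩ => .under (prod A As) B

/-- `Υ` is a sequence of all the formulae that represent the sequents of `S`, in an arbitrary
order (and possibly with repetitions). -/
def Enumerates {V : Type u} (Υ : List (Formula V)) (S : Set (Sequent V)) : Prop :=
  ∀ A : Formula V, A ∈ Υ ↔ ∃ s ∈ S, s.toFormula = A

/-- The sequence `!Υ`, in the extended language. -/
def bangSeq {V : Type u} (Υ : List (Formula V)) : List (ExpFormula V) :=
  Υ.map fun A => .bang A.toExp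

end ActionLogic

/-!
Derivability from `S` is reduced to hypothesis-free derivability with exponentials as follows.

*From `S` to `!Υ`.*  A block `!Υ` can be created, moved across any formulae, and absorbed into
another copy of itself.  Hence the sequents `Φ ⇒ C` such that `!Υ, Φ ⇒ C` is derivable are closed
under all the rules: in a rule with several premises every premise brings its own block, and the
superfluous ones are absorbed (`ExpDerivable.absorb_bangs`).  They contain `S`, since the formula
of each member of `S` occurs in `Υ` (`ExpDerivable.of_bang_toFormula`).

*From `!Υ` to `S`.*  No cut elimination is required.  Since derivability from `S` is closed under
cut, one may interpret the exponential in the language without it: `!A` becomes `1` if `⇒ A` is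
derivable from `S`, and `0` otherwise (`ExpFormula.collapse`).  Both constants are central,
idempotent and below `1`, so all the rules for `!` hold under this reading, and the interpretation
is sound (`ExpDerivable.collapse`).  It does not change formulae without `!`, and it turns `!Υ`
into a sequence of `1`s, which can be erased.
-/

namespace ActionLogic

variable {V : Type*}

/-! ### Derivability in the presence of a block of exponentials -/

namespace ExpDerivable

theorem weaken_bangs (Ξ Γ Δ : List (ExpFormula V)) (C : ExpFormula V)
    (h : ExpDerivable (Γ ++ Δ) C) : ExpDerivable (Γ ++ Ξ.map ExpFormula.bang ++ Δ) C := by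
  induction Ξ generalizing Γ with
  | nil => simpa using h
  | cons A Ξ ih => simpa using bangW Γ (Ξ.map ExpFormula.bang ++ Δ) A C (by simpa using ih Γ h)

theorem move_bangs (Ξ Γ Φ Δ : List (ExpFormula V)) (C : ExpFormula V)
    (h : ExpDerivable (Γ ++ Ξ.map ExpFormula.bang ++ Φ ++ Δ) C) :
    ExpDerivable (Γ ++ Φ ++ Ξ.map ExpFormula.bang ++ Δ) C := by
  induction Ξ generalizing Γ with
  | nil => simpa using h
  | cons A Ξ ih =>
    simpa using bangP₂ Γ Φ (Ξ.map ExpFormula.bang ++ Δ) A C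
      (by simpa using ih (Γ ++ [ExpFormula.bang A]) (by simpa using h))

/-- Exponentials can be dropped when further copies of them stand at the front: each is moved
next to its copy and contracted. -/
theorem absorb_bangs (Ω Ξ Γ Δ : List (ExpFormula V)) (C : ExpFormula V) (hΞ : Ξ ⊆ Ω)
    (h : ExpDerivable (Ω.map ExpFormula.bang ++ Γ ++ Ξ.map ExpFormula.bang ++ Δ) C) :
    ExpDerivable (Ω.map ExpFormula.bang ++ Γ ++ Δ) C := by
  induction Ξ with
  | nil => simpa using h
  | cons A Ξ ih =>
    obtain ⟨hA, hΞ⟩ := List.cons_subset.1 hΞ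
    refine ih hΞ ?_
    obtain ⟨Ω₁, Ω₂, rfl⟩ := List.append_of_mem hA
    have h₁ := bangP₁ (Ω₁.map ExpFormula.bang ++ [ExpFormula.bang A])
      (Ω₂.map ExpFormula.bang ++ Γ) (Ξ.map ExpFormula.bang ++ Δ) A C
      (by simpa using h)
    simpa using bangC (Ω₁.map ExpFormula.bang)
      (Ω₂.map ExpFormula.bang ++ Γ ++ Ξ.map ExpFormula.bang ++ Δ) A C
      (by simpa using h₁)

theorem absorb_flatten (Ω : List (ExpFormula V)) (Φs : List (List (ExpFormula V)))
    (Γ : List (ExpFormula V)) (C : ExpFormula V)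
    (h : ExpDerivable
      (Ω.map ExpFormula.bang ++ Γ ++ (Φs.map (Ω.map ExpFormula.bang ++ ·)).flatten) C) :
    ExpDerivable (Ω.map ExpFormula.bang ++ Γ ++ Φs.flatten) C := by
  induction Φs generalizing Γ with
  | nil => simpa using h
  | cons Φ Φs ih =>
    have h₁ := absorb_bangs Ω Ω Γ (Φ ++ (Φs.map (Ω.map ExpFormula.bang ++ ·)).flatten) C
      (List.Subset.refl _) (by simpa using h)
    simpa using ih (Γ ++ Φ) (by simpa using h₁)

theorem prodR (As : List (Formula V)) (Γ : List (ExpFormula V)) (A : Formula V)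
    (h : ExpDerivable Γ A.toExp) :
    ExpDerivable (Γ ++ As.map Formula.toExp) (prod A As).toExp := by
  induction As generalizing Γ A with
  | nil => simpa [prod] using h
  | cons B As ih => simpa [prod] using ih (Γ ++ [B.toExp]) (.mul A B) (mulR _ _ _ _ h (id _))

theorem of_bang_toFormula (s : Sequent V) :
    ExpDerivable (ExpFormula.bang s.toFormula.toExp :: s.ant.map Formula.toExp) s.succ.toExp := by
  obtain ⟨_ | ⟨A, As⟩, B⟩ := s
  · simpa [Sequent.toFormula] using bangL [] [] B.toExp B.toExp (id _)
  · have h₁ := underL [] _ [] _ _ _ (prodR As _ A (id _)) (id B.toExp)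
    have h₂ := bangL ([A.toExp] ++ As.map Formula.toExp) []
      (ExpFormula.under (prod A As).toExp B.toExp)
      B.toExp (by simpa using h₁)
    simpa [Sequent.toFormula, Formula.toExp] using
      bangP₁ [] ([A.toExp] ++ As.map Formula.toExp) []
      (ExpFormula.under (prod A As).toExp B.toExp)
        B.toExp (by simpa using h₂)

end ExpDerivable

theorem Derivable.toExp {S : Set (Sequent V)} (Ω : List (ExpFormula V))
    (hΩ : ∀ s ∈ S, s.toFormula.toExp ∈ Ω) {Φ : List (Formula V)} {C : Formula V}
    (h : Derivable S Φ C) :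
    ExpDerivable (Ω.map ExpFormula.bang ++ Φ.map Formula.toExp) C.toExp := by
  induction h with
  | hyp s hs =>
    obtain ⟨Ω₁, Ω₂, rfl⟩ := List.append_of_mem (hΩ s hs)
    have h₁ := ExpDerivable.weaken_bangs Ω₂ [_] _ _ (ExpDerivable.of_bang_toFormula s)
    simpa using ExpDerivable.weaken_bangs Ω₁ [] _ _ h₁
  | id A => exact ExpDerivable.weaken_bangs Ω [] _ _ (.id _)
  | underL Γ Φ Δ A B C _ _ ih₁ ih₂ =>
    have h := ExpDerivable.underL (Ω.map ExpFormula.bang ++ Γ.map Formula.toExp) _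
      (Δ.map Formula.toExp) _ B.toExp _ ih₁ (by simpa using ih₂)
    simpa [Formula.toExp] using ExpDerivable.absorb_bangs Ω Ω (Γ.map Formula.toExp)
      (Φ.map Formula.toExp ++ [ExpFormula.under A.toExp B.toExp] ++ Δ.map Formula.toExp) _
      (List.Subset.refl _) (by simpa using h)
  | underR Φ A B _ ih =>
    refine .underR _ _ _ ?_
    simpa using ExpDerivable.move_bangs Ω [] [A.toExp] (Φ.map Formula.toExp) _ (by simpa using ih)
  | overL Γ Φ Δ A B C _ _ ih₁ ih₂ =>
    have h := ExpDerivable.overL (Ω.map ExpFormula.bang ++ Γ.map Formula.toExp) _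
      (Δ.map Formula.toExp) _ B.toExp _ ih₁ (by simpa using ih₂)
    simpa [Formula.toExp] using ExpDerivable.absorb_bangs Ω Ω
      (Γ.map Formula.toExp ++ [ExpFormula.over B.toExp A.toExp])
      (Φ.map Formula.toExp ++ Δ.map Formula.toExp) _
      (List.Subset.refl _) (by simpa using h)
  | overR Φ A B _ ih => exact .overR _ _ _ (by simpa using ih)
  | mulL Γ Δ A B C _ ih =>
    simpa [Formula.toExp] using ExpDerivable.mulL (Ω.map ExpFormula.bang ++ Γ.map Formula.toExp)
      (Δ.map Formula.toExp) A.toExp B.toExp _ (by simpa using ih)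
  | mulR Γ Δ A B _ _ ih₁ ih₂ =>
    have h := ExpDerivable.mulR _ _ _ _ ih₁ ih₂
    simpa [Formula.toExp] using ExpDerivable.absorb_bangs Ω Ω (Γ.map Formula.toExp)
      (Δ.map Formula.toExp) _ (List.Subset.refl _) (by simpa using h)
  | oneL Γ Δ C _ ih =>
    simpa [Formula.toExp] using ExpDerivable.oneL (Ω.map ExpFormula.bang ++ Γ.map Formula.toExp)
      (Δ.map Formula.toExp) _ (by simpa using ih)
  | oneR => exact ExpDerivable.weaken_bangs Ω [] [] _ .oneR
  | zeroL Γ Δ C =>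
    simpa [Formula.toExp] using ExpDerivable.zeroL (Ω.map ExpFormula.bang ++ Γ.map Formula.toExp)
      (Δ.map Formula.toExp) C.toExp
  | plusL Γ Δ A₁ A₂ C _ _ ih₁ ih₂ =>
    simpa [Formula.toExp] using ExpDerivable.plusL (Ω.map ExpFormula.bang ++ Γ.map Formula.toExp)
      (Δ.map Formula.toExp) A₁.toExp A₂.toExp _ (by simpa using ih₁) (by simpa using ih₂)
  | plusR₁ Φ A₁ A₂ _ ih => exact .plusR₁ _ _ _ ih
  | plusR₂ Φ A₁ A₂ _ ih => exact .plusR₂ _ _ _ ih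
  | meetL₁ Γ Δ A₁ A₂ C _ ih =>
    simpa [Formula.toExp] using ExpDerivable.meetL₁ (Ω.map ExpFormula.bang ++ Γ.map Formula.toExp)
      (Δ.map Formula.toExp) A₁.toExp A₂.toExp _ (by simpa using ih)
  | meetL₂ Γ Δ A₁ A₂ C _ ih =>
    simpa [Formula.toExp] using ExpDerivable.meetL₂ (Ω.map ExpFormula.bang ++ Γ.map Formula.toExp)
      (Δ.map Formula.toExp) A₁.toExp A₂.toExp _ (by simpa using ih)
  | meetR Φ A₁ A₂ _ _ ih₁ ih₂ => exact .meetR _ _ _ ih₁ ih₂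
  | starL Γ Δ A C _ ih =>
    simpa [Formula.toExp] using ExpDerivable.starL (Ω.map ExpFormula.bang ++ Γ.map Formula.toExp)
      (Δ.map Formula.toExp) A.toExp _ (fun n => by simpa using ih n)
  | starR Φs A _ ih =>
    have h := ExpDerivable.starR
      ((Φs.map (List.map Formula.toExp)).map (Ω.map ExpFormula.bang ++ ·)) A.toExp
      (by simpa using ih)
    -- A further block is put in front, because for `n = 0` the rule leaves none.
    have h₁ := ExpDerivable.absorb_flatten Ω (Φs.map (List.map Formula.toExp)) [] _
      (by simpa using ExpDerivable.weaken_bangs Ω [] _ _ h)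
    simpa [Formula.toExp, List.map_flatten] using h₁
  | cut Γ Φ Δ A C _ _ ih₁ ih₂ =>
    have h := ExpDerivable.cut (Ω.map ExpFormula.bang ++ Γ.map Formula.toExp) _
      (Δ.map Formula.toExp) _ _ ih₁ (by simpa using ih₂)
    simpa using ExpDerivable.absorb_bangs Ω Ω (Γ.map Formula.toExp)
      (Φ.map Formula.toExp ++ Δ.map Formula.toExp) _ (List.Subset.refl _) (by simpa using h)

/-! ### Collapsing the exponentials to constants -/

namespace Derivable

variable {S : Set (Sequent V)}

theorem replicate_one_iff (n : ℕ) (Γ Δ : List (Formula V)) (C : Formula V) :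
    Derivable S (Γ ++ List.replicate n .one ++ Δ) C ↔ Derivable S (Γ ++ Δ) C := by
  induction n with
  | zero => simp
  | succ n ih =>
    rw [← ih]
    constructor
    · intro h
      simpa using cut Γ [] (List.replicate n .one ++ Δ) .one C oneR
        (by simpa [List.replicate_succ] using h)
    · intro h
      simpa [List.replicate_succ] using oneL Γ (List.replicate n .one ++ Δ) C (by simpa using h)

theorem one_iff (Γ Δ : List (Formula V)) (C : Formula V) :
    Derivable S (Γ ++ [.one] ++ Δ) C ↔ Derivable S (Γ ++ Δ) C :=
  replicate_one_iff 1 Γ Δ C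

theorem of_zero_mem {Φ : List (Formula V)} (h : .zero ∈ Φ) (C : Formula V) :
    Derivable S Φ C := by
  obtain ⟨Γ, Δ, rfl⟩ := List.append_of_mem h
  simpa using zeroL Γ Δ C

theorem prodL (As : List (Formula V)) (A C : Formula V)
    (h : Derivable S (A :: As) C) : Derivable S [prod A As] C := by
  induction As generalizing A with
  | nil => exact h
  | cons B As ih => exact ih (.mul A B) (mulL [] As A B C h)

theorem toFormula {s : Sequent V} (hs : s ∈ S) : Derivable S [] s.toFormula := by
  have h := hyp s hs
  obtain ⟨_ | ⟨A, As⟩, B⟩ := s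
  · exact h
  · exact underR _ _ _ (prodL As A B h)

end Derivable

open Classical in
/-- The interpretation of the extended language in the language without `!`, relative to a set
`S` of hypotheses: `!A` is read as `1` if (the reading of) `A` is derivable from `S`, and as `0`
otherwise. -/
noncomputable def ExpFormula.collapse (S : Set (Sequent V)) : ExpFormula V → Formula V
  | .var p => .var p
  | .zero => .zero
  | .one => .one
  | .under A B => .under (A.collapse S) (B.collapse S)
  | .over B A => .over (B.collapse S) (A.collapse S)
  | .mul A B => .mul (A.collapse S) (B.collapse S)
  | .plus A B => .plus (A.collapse S) (B.collapse S)
  | .meet A B => .meet (A.collapse S) (B.collapse S)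
  | .star A => .star (A.collapse S)
  | .bang A => if Derivable S [] (A.collapse S) then .one else .zero

@[simp]
theorem Formula.collapse_toExp (S : Set (Sequent V)) (A : Formula V) :
    A.toExp.collapse S = A := by
  induction A <;> simp_all [Formula.toExp, ExpFormula.collapse]

theorem ExpFormula.collapse_bang (S : Set (Sequent V)) (A : ExpFormula V) :
    Derivable S [] (A.collapse S) ∧ (ExpFormula.bang A).collapse S = .one ∨
      (ExpFormula.bang A).collapse S = .zero := by
  by_cases h : Derivable S [] (A.collapse S) <;> simp [ExpFormula.collapse, h]

theorem ExpDerivable.collapse (S : Set (Sequent V)) {Φ : List (ExpFormula V)}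
    {C : ExpFormula V} (h : ExpDerivable Φ C) :
    Derivable S (Φ.map (ExpFormula.collapse S)) (C.collapse S) := by
  induction h with
  | id A => exact .id _
  | underL Γ Φ Δ A B C _ _ ih₁ ih₂ =>
    simpa [ExpFormula.collapse] using Derivable.underL (Γ.map (ExpFormula.collapse S)) _
      (Δ.map (ExpFormula.collapse S)) _ (B.collapse S) _ ih₁ (by simpa using ih₂)
  | underR Φ A B _ ih => exact .underR _ _ _ ih
  | overL Γ Φ Δ A B C _ _ ih₁ ih₂ =>
    simpa [ExpFormula.collapse] using Derivable.overL (Γ.map (ExpFormula.collapse S)) _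
      (Δ.map (ExpFormula.collapse S)) _ (B.collapse S) _ ih₁ (by simpa using ih₂)
  | overR Φ A B _ ih => exact .overR _ _ _ (by simpa using ih)
  | mulL Γ Δ A B C _ ih =>
    simpa [ExpFormula.collapse] using Derivable.mulL (Γ.map (ExpFormula.collapse S))
      (Δ.map (ExpFormula.collapse S)) (A.collapse S) (B.collapse S) _ (by simpa using ih)
  | mulR Γ Δ A B _ _ ih₁ ih₂ =>
    simpa [ExpFormula.collapse] using Derivable.mulR _ _ _ _ ih₁ ih₂
  | oneL Γ Δ C _ ih =>
    simpa [ExpFormula.collapse] using Derivable.oneL (Γ.map (ExpFormula.collapse S))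
      (Δ.map (ExpFormula.collapse S)) _ (by simpa using ih)
  | oneR => exact .oneR
  | zeroL Γ Δ C => exact .of_zero_mem (by simp [ExpFormula.collapse]) _
  | plusL Γ Δ A₁ A₂ C _ _ ih₁ ih₂ =>
    simpa [ExpFormula.collapse] using Derivable.plusL (Γ.map (ExpFormula.collapse S))
      (Δ.map (ExpFormula.collapse S)) (A₁.collapse S) (A₂.collapse S) _
      (by simpa using ih₁) (by simpa using ih₂)
  | plusR₁ Φ A₁ A₂ _ ih => exact .plusR₁ _ _ _ ih
  | plusR₂ Φ A₁ A₂ _ ih => exact .plusR₂ _ _ _ ih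
  | meetL₁ Γ Δ A₁ A₂ C _ ih =>
    simpa [ExpFormula.collapse] using Derivable.meetL₁ (Γ.map (ExpFormula.collapse S))
      (Δ.map (ExpFormula.collapse S)) (A₁.collapse S) (A₂.collapse S) _ (by simpa using ih)
  | meetL₂ Γ Δ A₁ A₂ C _ ih =>
    simpa [ExpFormula.collapse] using Derivable.meetL₂ (Γ.map (ExpFormula.collapse S))
      (Δ.map (ExpFormula.collapse S)) (A₁.collapse S) (A₂.collapse S) _ (by simpa using ih)
  | meetR Φ A₁ A₂ _ _ ih₁ ih₂ => exact .meetR _ _ _ ih₁ ih₂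
  | starL Γ Δ A C _ ih =>
    simpa [ExpFormula.collapse] using Derivable.starL (Γ.map (ExpFormula.collapse S))
      (Δ.map (ExpFormula.collapse S)) (A.collapse S) _ (fun n => by simpa using ih n)
  | starR Φs A _ ih =>
    simpa [ExpFormula.collapse, List.map_flatten] using
      Derivable.starR (Φs.map (List.map (ExpFormula.collapse S))) (A.collapse S)
        (by simpa using ih)
  | cut Γ Φ Δ A C _ _ ih₁ ih₂ =>
    simpa using Derivable.cut (Γ.map (ExpFormula.collapse S)) _
      (Δ.map (ExpFormula.collapse S)) _ _ ih₁ (by simpa using ih₂)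
  | bangL Γ Δ A C _ ih =>
    rcases A.collapse_bang S with ⟨hA, h⟩ | h
    · have h₁ := Derivable.cut (Γ.map (ExpFormula.collapse S)) []
        (Δ.map (ExpFormula.collapse S)) _ _ hA (by simpa using ih)
      simpa [h] using (Derivable.one_iff _ _ _).2 (by simpa using h₁)
    · exact .of_zero_mem (by simp [h]) _
  | bangR Φ B _ ih =>
    by_cases h₀ : .zero ∈ (Φ.map ExpFormula.bang).map (ExpFormula.collapse S)
    · exact .of_zero_mem h₀ _
    · -- All the exponentials collapse to `1`, so the premise makes `B` derivable from `S`.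
      have h₁ : (Φ.map ExpFormula.bang).map (ExpFormula.collapse S) =
          List.replicate Φ.length .one := by
        refine List.eq_replicate_iff.2 ⟨by simp, fun X hX => ?_⟩
        simp only [List.map_map, List.mem_map, Function.comp_apply] at hX
        obtain ⟨A, hA, rfl⟩ := hX
        rcases A.collapse_bang S with ⟨-, h⟩ | h
        · exact h
        · exact absurd (List.mem_map.2 ⟨_, List.mem_map_of_mem hA, h⟩) h₀
      rw [h₁] at ih ⊢
      have hB : Derivable S [] (B.collapse S) := by
        simpa using (Derivable.replicate_one_iff Φ.length [] [] _).1 (by simpa using ih)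
      have hB' : (ExpFormula.bang B).collapse S = .one := by simp [ExpFormula.collapse, hB]
      rw [hB']
      simpa using (Derivable.replicate_one_iff Φ.length [] [] _).2 Derivable.oneR
  | bangP₁ Γ Φ Δ A C _ ih =>
    rcases A.collapse_bang S with ⟨-, h⟩ | h
    · have h₁ := (Derivable.one_iff ((Γ ++ Φ).map (ExpFormula.collapse S))
        (Δ.map (ExpFormula.collapse S)) _).1 (by simpa [h] using ih)
      simpa [h] using (Derivable.one_iff (Γ.map (ExpFormula.collapse S))
        ((Φ ++ Δ).map (ExpFormula.collapse S)) _).2 (by simpa using h₁)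
    · exact .of_zero_mem (by simp [h]) _
  | bangP₂ Γ Φ Δ A C _ ih =>
    rcases A.collapse_bang S with ⟨-, h⟩ | h
    · have h₁ := (Derivable.one_iff (Γ.map (ExpFormula.collapse S))
        ((Φ ++ Δ).map (ExpFormula.collapse S)) _).1 (by simpa [h] using ih)
      simpa [h] using (Derivable.one_iff ((Γ ++ Φ).map (ExpFormula.collapse S))
        (Δ.map (ExpFormula.collapse S)) _).2 (by simpa using h₁)
    · exact .of_zero_mem (by simp [h]) _
  | bangW Γ Δ A C _ ih =>
    rcases A.collapse_bang S with ⟨-, h⟩ | h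
    · simpa [h] using (Derivable.one_iff (Γ.map (ExpFormula.collapse S))
        (Δ.map (ExpFormula.collapse S)) _).2 (by simpa using ih)
    · exact .of_zero_mem (by simp [h]) _
  | bangC Γ Δ A C _ ih =>
    rcases A.collapse_bang S with ⟨-, h⟩ | h
    · simpa [h] using (Derivable.one_iff (Γ.map (ExpFormula.collapse S))
        (.one :: Δ.map (ExpFormula.collapse S)) _).1 (by simpa [h] using ih)
    · exact .of_zero_mem (by simp [h]) _

end ActionLogic

open ActionLogic in
theorem theorem2p4 {V : Type*} (S : Set (ActionLogic.Sequent V)) (_hS : S.Finite)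
    (Υ : List (ActionLogic.Formula V)) (_hΥ : ActionLogic.Enumerates Υ S)
    (Φ : List (ActionLogic.Formula V)) (C : ActionLogic.Formula V) :
    ActionLogic.Derivable S Φ C ↔
      ActionLogic.ExpDerivable
        (ActionLogic.bangSeq Υ ++ Φ.map ActionLogic.Formula.toExp) C.toExp := by
  constructor
  · intro h
    have hΩ : ∀ s ∈ S, s.toFormula.toExp ∈ Υ.map Formula.toExp := fun s hs =>
      List.mem_map_of_mem ((_hΥ _).2 ⟨s, hs, rfl⟩)
    simpa [bangSeq, Function.comp_def] using h.toExp (Υ.map Formula.toExp) hΩ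
  · intro h
    have h₁ : (bangSeq Υ).map (ExpFormula.collapse S) = List.replicate Υ.length .one := by
      refine List.eq_replicate_iff.2 ⟨by simp [bangSeq], fun X hX => ?_⟩
      simp only [bangSeq, List.map_map, List.mem_map, Function.comp_apply] at hX
      obtain ⟨A, hA, rfl⟩ := hX
      obtain ⟨s, hs, rfl⟩ := (_hΥ A).1 hA
      simp [ExpFormula.collapse, Derivable.toFormula hs]
    have h₂ := h.collapse S
    have h₃ : Φ.map (ExpFormula.collapse S ∘ Formula.toExp) = Φ := by
      simp [Function.comp_def]
    rw [List.map_append, h₁, List.map_map, h₃, Formula.collapse_toExp] at h₂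
    simpa using (Derivable.replicate_one_iff Υ.length [] Φ C).1 (by simpa using h₂)
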